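/- Let $A$ be a simple (not necessarily unital) complex $C^*$-algebra, i.e. one whose only closed two-sided ideals are $\{0\}$ and $A$, let $X$ be a locally compact Hausdorff space, and let $C_0(X,A)$ be the $C^*$-algebra of continuous functions $X\to A$ vanishing at infinity, with pointwise operations and the supremum norm. Then every closed two-sided ideal of $C_0(X,A)$ is of the form $$\tilde{J}(F):=\{f\in C_0(X,A) : f(x)=0 \text{ for all } x\in F\}$$ for some closed subset $F$ of $X$. -/

import Mathlib

open scoped ZeroAtInfty

/-- A closed two-sided ideal of a (not necessarily unital) complex algebra `B`: a complex linear
subspace which is topologically closed and absorbs multiplication from the left and the right.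
An ideal of an algebra without unit is a linear subspace by definition, so the carrier is a
`Submodule ℂ B` and not only an additive subgroup. -/
def IsClosedTwoSidedIdeal {B : Type*} [NonUnitalNonAssocRing B] [Module ℂ B] [TopologicalSpace B]
    (I : Submodule ℂ B) : Prop :=
  IsClosed (I : Set B) ∧ ∀ b : B, ∀ x ∈ I, b * x ∈ I ∧ x * b ∈ I

/-- A C⋆-algebra is simple if its only closed two-sided ideals are `0` and the whole algebra.
The zero algebra is not excluded. -/
def IsSimpleCStarAlgebra (A : Type*) [NonUnitalCStarAlgebra A] : Prop :=
  ∀ I : Submodule ℂ A, IsClosedTwoSidedIdeal I → I = ⊥ ∨ I = ⊤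

/-! Take `F` to be the common zero set of `I`. At `x ∉ F` the values of `I` are dense in `A`: their
closure is a nonzero closed ideal, since evaluation at `x` is onto, and `A` is simple. So any `g`
vanishing on `F` is approximated at each point by members of `I`. A partition of unity glues these
into a uniform approximation on a compact set off which `g` is small, and `I` is closed. -/

open Filter Topology

namespace ZeroAtInftyContinuousMap

variable {X : Type*} [TopologicalSpace X]

/-- The pointwise product of a continuous function with values in `[0, 1]` and a function vanishing
at infinity. -/
noncomputable def unitSMul {A : Type*} [NormedAddCommGroup A] [NormedSpace ℂ A] (φ : C(X, ℝ))
    (hφ : ∀ x, φ x ∈ Set.Icc (0 : ℝ) 1) (f : C₀(X, A)) : C₀(X, A) where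
  toFun x := (φ x : ℂ) • f x
  continuous_toFun := by fun_prop
  zero_at_infty' := by
    refine squeeze_zero_norm (fun x => ?_) (tendsto_norm_zero.comp f.zero_at_infty')
    rw [norm_smul, Complex.norm_real, Real.norm_of_nonneg (hφ x).1]
    exact mul_le_of_le_one_left (norm_nonneg _) (hφ x).2

@[simp]
lemma unitSMul_apply {A : Type*} [NormedAddCommGroup A] [NormedSpace ℂ A] (φ : C(X, ℝ))
    (hφ : ∀ x, φ x ∈ Set.Icc (0 : ℝ) 1) (f : C₀(X, A)) (x : X) :
    unitSMul φ hφ f x = (φ x : ℂ) • f x := rfl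

lemma norm_apply_le {A : Type*} [NormedAddCommGroup A] (f : C₀(X, A)) (x : X) :
    ‖f x‖ ≤ ‖f‖ := by
  rw [← norm_toBCF_eq_norm]
  exact f.toBCF.norm_coe_le_norm x

lemma norm_le_of_forall_apply_le {A : Type*} [NormedAddCommGroup A] {f : C₀(X, A)} {C : ℝ}
    (hC : 0 ≤ C) (h : ∀ x, ‖f x‖ ≤ C) : ‖f‖ ≤ C := by
  rw [← norm_toBCF_eq_norm]
  exact (BoundedContinuousFunction.norm_le hC).2 h

lemma norm_unitSMul_le {A : Type*} [NormedAddCommGroup A] [NormedSpace ℂ A] (φ : C(X, ℝ))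
    (hφ : ∀ x, φ x ∈ Set.Icc (0 : ℝ) 1) (f : C₀(X, A)) : ‖unitSMul φ hφ f‖ ≤ ‖f‖ := by
  refine norm_le_of_forall_apply_le (norm_nonneg _) fun x => ?_
  rw [unitSMul_apply, norm_smul, Complex.norm_real, Real.norm_of_nonneg (hφ x).1]
  exact (mul_le_of_le_one_left (norm_nonneg _) (hφ x).2).trans (norm_apply_le f x)

/-- In a locally compact Hausdorff space every value is attained at a prescribed point by a
continuous function vanishing at infinity. -/
lemma exists_apply_eq [T2Space X] [LocallyCompactSpace X] {A : Type*} [NormedAddCommGroup A]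
    [NormedSpace ℂ A] (x : X) (a : A) : ∃ f : C₀(X, A), f x = a := by
  obtain ⟨φ, h1, -, hc, -⟩ := exists_continuous_one_zero_of_isCompact
    (isCompact_singleton (x := x)) isClosed_empty (Set.disjoint_empty _)
  refine ⟨⟨⟨fun y => (φ y : ℂ) • a, by fun_prop⟩, ?_⟩, ?_⟩
  · have hs : HasCompactSupport fun y => (φ y : ℂ) • a :=
      hc.mono fun y hy h0 => hy (by simp [h0])
    exact hs.is_zero_at_infty
  · change (φ x : ℂ) • a = a
    simp [h1 (Set.mem_singleton x)]

end ZeroAtInftyContinuousMap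

open ZeroAtInftyContinuousMap

/-- Every element of a C⋆-algebra is a limit of its left multiples. -/
lemma NonUnitalCStarAlgebra.exists_norm_mul_sub_lt {B : Type*} [NonUnitalCStarAlgebra B] (b : B)
    {ε : ℝ} (hε : 0 < ε) : ∃ u : B, ‖u * b - b‖ < ε := by
  -- The increasing approximate unit is indexed through an order on `B`; the spectral order supplies
  -- one.
  let _ := CStarAlgebra.spectralOrder B
  let _ := CStarAlgebra.spectralOrderedRing B
  have h := (CStarAlgebra.increasingApproximateUnit B).tendsto_mul_right b
  obtain ⟨u, hu⟩ := (h.eventually (Metric.ball_mem_nhds b hε)).exists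
  exact ⟨u, by simpa [dist_eq_norm] using hu⟩

namespace IsClosedTwoSidedIdeal

variable {A : Type*} [NonUnitalCStarAlgebra A] {X : Type*} [TopologicalSpace X]
  {I : Submodule ℂ C₀(X, A)}

/-- Scalar functions need not lie in `C₀(X, A)`, so absorption does not apply directly. But `φ f` is
a limit of products `(φ u) f` with `u f` close to `f`. -/
lemma unitSMul_mem (hI : IsClosedTwoSidedIdeal I) (φ : C(X, ℝ))
    (hφ : ∀ x, φ x ∈ Set.Icc (0 : ℝ) 1) {f : C₀(X, A)} (hf : f ∈ I) :
    unitSMul φ hφ f ∈ I := by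
  rw [← SetLike.mem_coe, ← hI.1.closure_eq, Metric.mem_closure_iff]
  intro ε hε
  obtain ⟨u, hu⟩ := NonUnitalCStarAlgebra.exists_norm_mul_sub_lt f hε
  refine ⟨unitSMul φ hφ u * f, (hI.2 _ f hf).1, ?_⟩
  have : unitSMul φ hφ u * f - unitSMul φ hφ f = unitSMul φ hφ (u * f - f) := by
    ext x
    simp [smul_sub, smul_mul_assoc]
  rw [dist_comm, dist_eq_norm, this]
  exact (norm_unitSMul_le φ hφ _).trans_lt hu

/-- At a point where some member of a closed ideal of `C₀(X, A)` does not vanish, with `A` simple,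
the members of the ideal take a dense set of values. -/
lemma exists_norm_apply_sub_lt [T2Space X] [LocallyCompactSpace X]
    (hA : IsSimpleCStarAlgebra A) (hI : IsClosedTwoSidedIdeal I) {x : X}
    (hx : ∃ f ∈ I, f x ≠ 0) (a : A) {ε : ℝ} (hε : 0 < ε) : ∃ f ∈ I, ‖f x - a‖ < ε := by
  let ev : C₀(X, A) →ₗ[ℂ] A :=
    { toFun := fun f => f x, map_add' := fun _ _ => rfl, map_smul' := fun _ _ => rfl }
  let J : Submodule ℂ A := (I.map ev).topologicalClosure
  have hJ : IsClosedTwoSidedIdeal J := by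
    refine ⟨(I.map ev).isClosed_topologicalClosure, fun b y hy => ?_⟩
    obtain ⟨g, hg⟩ := ZeroAtInftyContinuousMap.exists_apply_eq x b
    constructor
    · refine map_mem_closure (f := fun z => b * z) (by fun_prop) hy ?_
      rintro _ ⟨f, hf, rfl⟩
      exact ⟨g * f, (hI.2 g f hf).1, by simp [ev, hg]⟩
    · refine map_mem_closure (f := fun z => z * b) (by fun_prop) hy ?_
      rintro _ ⟨f, hf, rfl⟩
      exact ⟨f * g, (hI.2 g f hf).2, by simp [ev, hg]⟩
  obtain ⟨f, hf, hfx⟩ := hx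
  have hfJ : f x ∈ J := (I.map ev).le_topologicalClosure ⟨f, hf, rfl⟩
  have hJtop : J = ⊤ := (hA J hJ).resolve_left fun h => hfx (by simpa [h] using hfJ)
  have ha : a ∈ closure (I.map ev : Set A) := by
    have : a ∈ J := hJtop ▸ Submodule.mem_top
    exact this
  obtain ⟨_, ⟨g, hg, rfl⟩, hga⟩ := Metric.mem_closure_iff.1 ha ε hε
  exact ⟨g, hg, by rwa [dist_comm, dist_eq_norm] at hga⟩

/-- A function that is approximated at every point by members of a closed ideal belongs to it. -/
lemma mem_of_forall_exists_norm_apply_sub_lt [T2Space X] [LocallyCompactSpace X]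
    (hI : IsClosedTwoSidedIdeal I) {g : C₀(X, A)}
    (hg : ∀ x, ∀ ε > 0, ∃ f ∈ I, ‖f x - g x‖ < ε) : g ∈ I := by
  rw [← SetLike.mem_coe, ← hI.1.closure_eq, Metric.mem_closure_iff]
  intro δ hδ
  -- Pointwise bounds yield only `≤ ε` for the supremum norm; `ε < δ` restores strictness.
  obtain ⟨ε, hε, hεδ⟩ := exists_between hδ
  obtain ⟨K, hK, hgK⟩ : ∃ K, IsCompact K ∧ ∀ y ∉ K, ‖g y‖ < ε := by
    have h := (tendsto_norm_zero.comp g.zero_at_infty').eventually (gt_mem_nhds hε)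
    obtain ⟨K, hK, hKg⟩ := mem_cocompact.1 h
    exact ⟨K, hK, fun y hy => hKg hy⟩
  choose f hfI hf using fun x => hg x ε hε
  let U : X → Set X := fun x => {y | ‖f x y - g y‖ < ε}
  have hU : ∀ x, IsOpen (U x) := fun x => isOpen_lt (by fun_prop) continuous_const
  obtain ⟨t, ht⟩ := hK.elim_finite_subcover U hU fun x _ => Set.mem_iUnion.2 ⟨x, hf x⟩
  obtain ⟨ρ, hρ, -⟩ := PartitionOfUnity.exists_isSubordinate_of_locallyFinite_t2space hK
    (fun i : t => U i) (fun i => hU i) (locallyFinite_of_finite _)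
    (by simpa [Set.iUnion_subtype] using ht)
  have hρ01 : ∀ i x, ρ i x ∈ Set.Icc (0 : ℝ) 1 := fun i x => ⟨ρ.nonneg i x, ρ.le_one i x⟩
  refine ⟨∑ i, unitSMul (ρ i) (hρ01 i) (f i),
    I.sum_mem fun i _ => hI.unitSMul_mem _ _ (hfI i), ?_⟩
  rw [dist_comm, dist_eq_norm]
  refine (norm_le_of_forall_apply_le hε.le fun y => ?_).trans_lt hεδ
  have hsum : (∑ i, unitSMul (ρ i) (hρ01 i) (f i)) y = ∑ i, (ρ i y : ℂ) • f i y := by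
    let ev : C₀(X, A) →+ A :=
      { toFun := fun h => h y, map_zero' := rfl, map_add' := fun _ _ => rfl }
    exact map_sum ev _ _
  -- The weight missing from the partition falls on `g y`: it is zero on `K`, and off `K` the value
  -- `g y` is small. The error is thus bounded by a convex combination of quantities at most `ε`.
  have hsplit : (∑ i, unitSMul (ρ i) (hρ01 i) (f i) - g) y =
      ∑ i, (ρ i y : ℂ) • (f i y - g y) - ((1 - ∑ i, ρ i y : ℝ) : ℂ) • g y := by
    rw [ZeroAtInftyContinuousMap.sub_apply, hsum]
    simp only [smul_sub, Finset.sum_sub_distrib, ← Finset.sum_smul]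
    push_cast
    rw [sub_smul, one_smul]
    abel
  have hle : ∑ i, ρ i y ≤ 1 := by
    simpa [finsum_eq_sum_of_fintype] using ρ.sum_le_one y
  have hterm : ∀ i, ‖(ρ i y : ℂ) • (f i y - g y)‖ ≤ ρ i y * ε := by
    intro i
    rw [norm_smul, Complex.norm_real, Real.norm_of_nonneg (ρ.nonneg i y)]
    by_cases hi : y ∈ U i
    · exact mul_le_mul_of_nonneg_left (le_of_lt hi) (ρ.nonneg i y)
    · have h0 : ρ i y = 0 := image_eq_zero_of_notMem_tsupport fun h => hi (hρ i h)
      simp [h0]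
  have hrest : ‖((1 - ∑ i, ρ i y : ℝ) : ℂ) • g y‖ ≤ (1 - ∑ i, ρ i y) * ε := by
    rw [norm_smul, Complex.norm_real, Real.norm_of_nonneg (sub_nonneg.2 hle)]
    by_cases hy : y ∈ K
    · have h1 : ∑ i, ρ i y = 1 := by
        simpa [finsum_eq_sum_of_fintype] using ρ.sum_eq_one hy
      rw [h1, sub_self, zero_mul, zero_mul]
    · exact mul_le_mul_of_nonneg_left (hgK y hy).le (sub_nonneg.2 hle)
  calc ‖(∑ i, unitSMul (ρ i) (hρ01 i) (f i) - g) y‖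
      ≤ ∑ i, ρ i y * ε + (1 - ∑ i, ρ i y) * ε := by
        rw [hsplit]
        exact (norm_sub_le _ _).trans
          (add_le_add ((norm_sum_le _ _).trans (Finset.sum_le_sum fun i _ => hterm i)) hrest)
    _ = ε := by rw [← Finset.sum_mul]; ring

end IsClosedTwoSidedIdeal

theorem proposition4 {A : Type*} [NonUnitalCStarAlgebra A] (hA : IsSimpleCStarAlgebra A)
    {X : Type*} [TopologicalSpace X] [T2Space X] [LocallyCompactSpace X]
    (I : Submodule ℂ C₀(X, A)) (hI : IsClosedTwoSidedIdeal I) :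
    ∃ F : Set X, IsClosed F ∧ (I : Set C₀(X, A)) = {f : C₀(X, A) | ∀ x ∈ F, f x = 0} := by
  refine ⟨{x | ∀ f ∈ I, f x = 0}, ?_, ?_⟩
  · simp only [Set.ofPred_forall]
    exact isClosed_iInter fun f => isClosed_iInter fun _ =>
      isClosed_eq (map_continuous f) continuous_const
  · refine Set.Subset.antisymm (fun f hf x hx => hx f hf) fun g hg => ?_
    refine hI.mem_of_forall_exists_norm_apply_sub_lt fun x ε hε => ?_
    by_cases hx : ∀ f ∈ I, f x = 0
    · exact ⟨0, I.zero_mem, by simpa [hg x hx] using hε⟩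
    · push Not at hx
      exact hI.exists_norm_apply_sub_lt hA hx (g x) hε
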